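/- Let $m,\gamma\in\mathbb R$ with $m\ge -\tfrac12$. Consider the boundary value problem $$f'''+(m+2)\,f f''-(2m+1)\,(f')^2=0 \quad\text{on } [0,\infty),\qquad f(0)=-\gamma,\qquad \lim_{t\to\infty}f'(t)=0,\qquad f''(0)=-1,$$ where a solution is a three times continuously differentiable function $f:[0,\infty)\to\mathbb R$ (with one-sided derivatives at $0$). This problem has exactly one concave solution $f$. Moreover, this solution is positive at infinity, i.e. there is $t_0\ge 0$ such that $f(t)>0$ for all $t\ge t_0$, and it satisfies $$-\gamma\le f(t)\le\sqrt{\gamma^2+\frac{2f'(0)}{m+2}}\qquad\text{for all } t\ge 0.$$ -/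

import Mathlib

open Set Filter Topology

/-- `f` is a classical solution on `[0, ∞)` of
`f''' + (m + 2) f f'' - (2 m + 1) f' ^ 2 = 0`, with `f(0) = -γ`, `f'(t) → 0` as `t → ∞`
and `f''(0) = -1`. Only the values of `f` on `[0, ∞)` matter; derivatives are taken within
`[0, ∞)`, so they are one-sided at `0`. -/
structure IsBoundaryLayerSolution (m γ : ℝ) (f : ℝ → ℝ) : Prop where
  contDiffOn : ContDiffOn ℝ 3 f (Ici 0)
  ode : ∀ t : ℝ, 0 ≤ t →
    iteratedDerivWithin 3 f (Ici 0) t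
      + (m + 2) * f t * iteratedDerivWithin 2 f (Ici 0) t
      - (2 * m + 1) * (derivWithin f (Ici 0) t) ^ 2 = 0
  value_zero : f 0 = -γ
  deriv_infty : Tendsto (fun t : ℝ => derivWithin f (Ici 0) t) atTop (𝓝 0)
  second_deriv_zero : iteratedDerivWithin 2 f (Ici 0) 0 = -1

/-- A concave solution of the boundary value problem on `[0, ∞)`. -/
structure IsConcaveBoundaryLayerSolution (m γ : ℝ) (f : ℝ → ℝ) : Prop
    extends IsBoundaryLayerSolution m γ f where
  concaveOn : ConcaveOn ℝ (Ici 0) f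

/-! Put a = m + 2 and b = 2m + 1, so that a > 1, b ≥ 0 and b = 2a - 3.

Existence is by shooting in α = f'(0). Along a trajectory the flux f'' + a f f' has derivative (a +
b) f'² ≥ 0, and f'' stays positive once it is positive. Hence a trajectory that reaches positive
flux or positive f'' while f' > 0 (overshoot) cannot also reach negative slope with negative flux
(undershoot). Both sets of slopes are open, 0 undershoots and some steep slope overshoots, so by
connectedness some α > 0 does neither (`exists_trapped_solution`). Its trajectory keeps f' > 0, f''
≤ 0 and flux ≤ 0. The flux is also the derivative of f' + (a/2) f², which therefore decreases: this
bounds f, gives global existence and the square-root estimate, and forces f' → 0, since f is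
bounded.

Positivity at infinity (`SolvesOn.eventually_pos`): otherwise f increases to a limit l ≤ 0. The case
l < 0 makes f'' positive somewhere. For l = 0 the relation b = 2a - 3 makes flux / f³ increasing; it
is bounded, yet grows at least like -log |f|, a contradiction.

Uniqueness (`IsConcaveBoundaryLayerSolution.derivWithin_zero_le`) is a comparison: for two concave
solutions the gap of the slopes, if initially positive, never falls below its initial value, while
both slopes tend to 0. -/

theorem exists_first_zero {φ : ℝ → ℝ} {T : ℝ} (hT : 0 ≤ T) (hφ : ContinuousOn φ (Icc 0 T))
    (h0 : 0 < φ 0) (h1 : φ T ≤ 0) :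
    ∃ s ∈ Ioc 0 T, φ s = 0 ∧ ∀ t ∈ Ico 0 s, 0 < φ t := by
  have hc : IsCompact (Icc 0 T ∩ φ ⁻¹' Iic 0) :=
    isCompact_Icc.of_isClosed_subset (hφ.preimage_isClosed_of_isClosed isClosed_Icc isClosed_Iic)
      inter_subset_left
  obtain ⟨s, ⟨hs, hs0⟩, hleast⟩ := hc.exists_isLeast ⟨T, ⟨hT, le_rfl⟩, h1⟩
  have hs0' : φ s ≤ 0 := hs0
  have hpos : 0 < s := by
    rcases hs.1.eq_or_lt with h | h
    · subst h; linarith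
    · exact h
  refine ⟨s, ⟨hpos, hs.2⟩, ?_, fun t ht => ?_⟩
  · obtain ⟨t, ht, hte⟩ := intermediate_value_Icc' hpos.le
      (hφ.mono (Icc_subset_Icc_right hs.2)) ⟨hs0', h0.le⟩
    have : s ≤ t := hleast ⟨⟨ht.1, ht.2.trans hs.2⟩, hte.le⟩
    rwa [le_antisymm this ht.2]
  · by_contra! h
    exact absurd (hleast ⟨⟨ht.1, ht.2.le.trans hs.2⟩, h⟩) (not_le.2 ht.2)

/-! ### Autonomous equations with locally Lipschitz field. -/

section GenericODE

variable {E : Type*} [NormedAddCommGroup E] [NormedSpace ℝ E]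

/-- `u` solves the autonomous equation `u' = v u` at every point of `s ⊆ [0, ∞)`. -/
def SolvesOn (v : E → E) (u : ℝ → E) (s : Set ℝ) : Prop :=
  ∀ t ∈ s, HasDerivWithinAt u (v (u t)) (Ici 0) t

/-- On every ball, `v` agrees with a bounded, globally Lipschitz field. -/
def HasLipschitzTruncations (v : E → E) : Prop :=
  ∀ R : ℝ, ∃ (w : E → E) (K L : NNReal), LipschitzWith K w ∧ (∀ p, ‖w p‖ ≤ L) ∧
    ∀ p, ‖p‖ ≤ R → w p = v p

namespace SolvesOn

variable {v w : E → E} {u u' : ℝ → E} {s : Set ℝ} {T : ℝ}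

theorem mono {r : Set ℝ} (h : SolvesOn v u s) (hr : r ⊆ s) : SolvesOn v u r :=
  fun t ht => h t (hr ht)

theorem continuousOn (h : SolvesOn v u s) (hs : s ⊆ Ici 0) : ContinuousOn u s :=
  fun t ht => (h t ht).continuousWithinAt.mono hs

theorem congr_field (h : SolvesOn v u s) (hw : ∀ t ∈ s, v (u t) = w (u t)) : SolvesOn w u s :=
  fun t ht => hw t ht ▸ h t ht

theorem hasDerivWithinAt_Ici (h : SolvesOn v u (Icc 0 T)) {t : ℝ} (ht : t ∈ Icc 0 T) :
    HasDerivWithinAt u (v (u t)) (Ici t) t :=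
  (h t ht).mono (Ici_subset_Ici.2 ht.1)

theorem hasDerivAt (h : SolvesOn v u s) {t : ℝ} (ht : t ∈ s) (h0 : 0 < t) :
    HasDerivAt u (v (u t)) t :=
  (h t ht).hasDerivAt (Ici_mem_nhds h0)

theorem exists_norm_le (h : SolvesOn v u (Icc 0 T)) : ∃ R, ∀ t ∈ Icc 0 T, ‖u t‖ ≤ R :=
  isCompact_Icc.exists_bound_of_continuousOn (h.continuousOn Icc_subset_Ici_self)

theorem exists_common_truncation (hv : HasLipschitzTruncations v) (h : SolvesOn v u (Icc 0 T))
    (h' : SolvesOn v u' (Icc 0 T)) :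
    ∃ (w : E → E) (K : NNReal), LipschitzWith K w ∧ SolvesOn w u (Icc 0 T) ∧
      SolvesOn w u' (Icc 0 T) := by
  obtain ⟨R, hR⟩ := h.exists_norm_le
  obtain ⟨R', hR'⟩ := h'.exists_norm_le
  obtain ⟨w, K, L, hK, -, hw⟩ := hv (max R R')
  exact ⟨w, K, hK, h.congr_field fun t ht => (hw _ ((hR t ht).trans (le_max_left _ _))).symm,
    h'.congr_field fun t ht => (hw _ ((hR' t ht).trans (le_max_right _ _))).symm⟩

theorem eqOn (hv : HasLipschitzTruncations v) (h : SolvesOn v u (Icc 0 T))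
    (h' : SolvesOn v u' (Icc 0 T)) (h0 : u 0 = u' 0) : EqOn u u' (Icc 0 T) := by
  obtain ⟨w, K, hK, hw, hw'⟩ := exists_common_truncation hv h h'
  exact ODE_solution_unique (v := fun _ => w) (fun _ => hK) (hw.continuousOn Icc_subset_Ici_self)
    (fun t ht => hw.hasDerivWithinAt_Ici (Ico_subset_Icc_self ht))
    (hw'.continuousOn Icc_subset_Ici_self)
    (fun t ht => hw'.hasDerivWithinAt_Ici (Ico_subset_Icc_self ht)) h0

theorem eqOn_of_eq_right (hv : HasLipschitzTruncations v) (h : SolvesOn v u (Icc 0 T))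
    (h' : SolvesOn v u' (Icc 0 T)) (hT : u T = u' T) : EqOn u u' (Icc 0 T) := by
  obtain ⟨w, K, hK, hw, hw'⟩ := exists_common_truncation hv h h'
  exact ODE_solution_unique_of_mem_Icc_left (v := fun _ => w) (s := fun _ => univ)
    (fun _ _ => hK.lipschitzOnWith)
    (hw.continuousOn Icc_subset_Ici_self)
    (fun t ht => (hw.hasDerivAt (Ioc_subset_Icc_self ht) ht.1).hasDerivWithinAt)
    (fun _ _ => trivial)
    (hw'.continuousOn Icc_subset_Ici_self)
    (fun t ht => (hw'.hasDerivAt (Ioc_subset_Icc_self ht) ht.1).hasDerivWithinAt)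
    (fun _ _ => trivial) hT

variable [CompleteSpace E]

theorem exists_of_lipschitz_of_bounded {K L : NNReal} (hK : LipschitzWith K w)
    (hL : ∀ p, ‖w p‖ ≤ L) (u₀ : E) (hT : 0 ≤ T) :
    ∃ u : ℝ → E, u 0 = u₀ ∧ SolvesOn w u (Icc 0 T) := by
  -- Solving on a strictly larger interval makes the derivative two-sided on `[0, T]`, as `SolvesOn`
  -- requires at `T`.
  have hpl : IsPicardLindelof (fun _ => w) (tmin := -(T + 1)) (tmax := T + 1)
      ⟨0, by constructor <;> linarith⟩ u₀ (L * (T + 1).toNNReal) 0 L K :=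
    IsPicardLindelof.of_time_independent (fun p _ => hL p) hK.lipschitzOnWith
      (by simpa using mul_le_mul_of_nonneg_left (le_max_left (T + 1) 0) L.2)
  obtain ⟨u, h0, hu⟩ := hpl.exists_eq_forall_mem_Icc_hasDerivWithinAt₀
  refine ⟨u, h0, fun t ht => ?_⟩
  exact ((hu t ⟨by linarith [ht.1], by linarith [ht.2]⟩).hasDerivAt
    (Icc_mem_nhds (by linarith [ht.1]) (by linarith [ht.2]))).hasDerivWithinAt

/-- Solutions on a compact interval depend continuously on the initial value; in particular nearby
initial values have solutions on the whole interval. -/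
theorem exists_near (hv : HasLipschitzTruncations v) (hT : 0 ≤ T) (h : SolvesOn v u (Icc 0 T))
    {ε : ℝ} (hε : 0 < ε) :
    ∃ δ > 0, ∀ p, dist p (u 0) < δ → ∃ u' : ℝ → E, u' 0 = p ∧ SolvesOn v u' (Icc 0 T) ∧
      ∀ t ∈ Icc 0 T, dist (u' t) (u t) < ε := by
  obtain ⟨R, hR⟩ := h.exists_norm_le
  obtain ⟨w, K, L, hK, hL, hw⟩ := hv (R + ε)
  have hwu : SolvesOn w u (Icc 0 T) :=
    h.congr_field fun t ht => (hw _ ((hR t ht).trans (by linarith))).symm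
  -- Grönwall for the truncated field costs a factor `exp (K * T)`; staying `ε`-close keeps the new
  -- trajectory in the ball where the truncation is exact.
  refine ⟨ε * Real.exp (-(K * T)), by positivity, fun p hp => ?_⟩
  obtain ⟨u', h0, hu'⟩ := exists_of_lipschitz_of_bounded hK hL p hT
  have hd : ∀ t ∈ Icc 0 T, dist (u' t) (u t) < ε := fun t ht => by
    have h1 := dist_le_of_trajectories_ODE (v := fun _ => w) (fun _ => hK)
      (hu'.continuousOn Icc_subset_Ici_self)
      (fun t ht => hu'.hasDerivWithinAt_Ici (Ico_subset_Icc_self ht))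
      (hwu.continuousOn Icc_subset_Ici_self)
      (fun t ht => hwu.hasDerivWithinAt_Ici (Ico_subset_Icc_self ht)) le_rfl t ht
    rw [h0] at h1
    calc dist (u' t) (u t) ≤ dist p (u 0) * Real.exp (K * (t - 0)) := h1
      _ ≤ dist p (u 0) * Real.exp (K * T) := by
        gcongr
        linarith [ht.2]
      _ < ε * Real.exp (-(K * T)) * Real.exp (K * T) := by gcongr
      _ = ε := by rw [mul_assoc, ← Real.exp_add]; simp
  refine ⟨u', h0, hu'.congr_field fun t ht => hw _ ?_, hd⟩
  have h2 := norm_le_norm_add_norm_sub (u t) (u' t)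
  rw [← dist_eq_norm, dist_comm] at h2
  linarith [hR t ht, hd t ht]

theorem exists_extension (hv : HasLipschitzTruncations v) (hT : 0 ≤ T)
    (h : SolvesOn v u (Icc 0 T)) :
    ∃ T' > T, ∃ u' : ℝ → E, SolvesOn v u' (Icc 0 T') ∧ EqOn u' u (Icc 0 T) := by
  obtain ⟨R, hR⟩ := h.exists_norm_le
  obtain ⟨w, K, L, hK, hL, hw⟩ := hv (R + 1)
  obtain ⟨u', h0, hu'⟩ := exists_of_lipschitz_of_bounded hK hL (u 0) (by linarith : 0 ≤ T + 1)
  have hwu : SolvesOn w u (Icc 0 T) :=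
    h.congr_field fun t ht => (hw _ ((hR t ht).trans (by linarith))).symm
  have hwv : HasLipschitzTruncations w := fun _ => ⟨w, K, L, hK, hL, fun _ _ => rfl⟩
  have heq : EqOn u' u (Icc 0 T) :=
    eqOn hwv (hu'.mono (Icc_subset_Icc_right (by linarith))) hwu h0
  have hlt : ‖u' T‖ < R + 1 := by
    rw [heq ⟨hT, le_rfl⟩]
    linarith [hR T ⟨hT, le_rfl⟩]
  have hev : ∀ᶠ t in 𝓝[≥] T, ‖u' t‖ < R + 1 :=
    ((hu'.hasDerivWithinAt_Ici ⟨hT, by linarith⟩).continuousWithinAt.norm).eventually_lt_const hlt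
  obtain ⟨r, hr, hsub⟩ := mem_nhdsGE_iff_exists_Icc_subset.1 hev
  refine ⟨min r (T + 1), lt_min hr (by linarith), u', ?_, heq⟩
  refine (hu'.mono (Icc_subset_Icc_right (min_le_right _ _))).congr_field fun t ht => hw _ ?_
  rcases le_total t T with h | h
  · rw [heq ⟨ht.1, h⟩]
    linarith [hR t ⟨ht.1, h⟩]
  · exact (hsub ⟨h, ht.2.trans (min_le_left _ _)⟩ : ‖u' t‖ < R + 1).le

/-- An a priori bound gives a global solution. -/
theorem exists_global (hv : HasLipschitzTruncations v) {u₀ : E} {R : ℝ} (h0 : ‖u₀‖ < R)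
    (hR : ∀ T, 0 ≤ T → ∀ u : ℝ → E, u 0 = u₀ → SolvesOn v u (Icc 0 T) → ‖u T‖ < R) :
    ∃ u : ℝ → E, u 0 = u₀ ∧ SolvesOn v u (Ici 0) := by
  have key : ∀ n : ℕ, ∃ u : ℝ → E, u 0 = u₀ ∧ SolvesOn v u (Icc 0 n) := fun n => by
    obtain ⟨w, K, L, hK, hL, hw⟩ := hv R
    obtain ⟨u, hu0, hu⟩ := exists_of_lipschitz_of_bounded hK hL u₀ n.cast_nonneg
    refine ⟨u, hu0, hu.congr_field fun t ht => hw _ ?_⟩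
    -- Up to the first time its norm equals `R`, the truncated solution is a genuine one, which `hR`
    -- forbids.
    by_contra! hlt
    have ht' : Icc 0 t ⊆ Icc 0 (n : ℝ) := Icc_subset_Icc_right ht.2
    obtain ⟨s, hs, hs0, hpos⟩ := exists_first_zero (φ := fun t => R - ‖u t‖) ht.1
      (continuousOn_const.sub ((hu.continuousOn Icc_subset_Ici_self).mono ht').norm)
      (by simpa [hu0] using h0) (by linarith)
    have hbd : ∀ r ∈ Icc 0 s, ‖u r‖ ≤ R := fun r hr => by
      rcases hr.2.eq_or_lt with h | h
      · rw [h]; linarith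
      · linarith [hpos r ⟨hr.1, h⟩]
    have := hR s hs.1.le u hu0 ((hu.mono ((Icc_subset_Icc_right hs.2).trans ht')).congr_field
      fun r hr => hw _ (hbd r hr))
    linarith
  choose U hU0 hU using key
  have hag : ∀ (n k : ℕ) (t : ℝ), 0 ≤ t → t ≤ n → t ≤ k → U n t = U k t := fun n k t h0 h1 h2 =>
    eqOn hv ((hU n).mono (Icc_subset_Icc_right h1)) ((hU k).mono (Icc_subset_Icc_right h2))
      ((hU0 n).trans (hU0 k).symm) ⟨h0, le_rfl⟩
  refine ⟨fun t => U ⌈t⌉₊ t, by simp [hU0], fun t ht => ?_⟩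
  have ht0 : (0 : ℝ) ≤ t := ht
  have hlt : t < ((⌈t⌉₊ + 1 : ℕ) : ℝ) := by push_cast; linarith [Nat.le_ceil t]
  -- The index jumps at integers; by uniqueness the single index `⌈t⌉₊ + 1` serves on a whole
  -- neighbourhood of `t`.
  have hev : (fun t => U ⌈t⌉₊ t) =ᶠ[𝓝[Ici 0] t] U (⌈t⌉₊ + 1) := by
    filter_upwards [self_mem_nhdsWithin, mem_nhdsWithin_of_mem_nhds (Iio_mem_nhds hlt)] with s hs hs'
    exact hag _ _ _ hs (Nat.le_ceil s) (le_of_lt hs')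
  have he : U ⌈t⌉₊ t = U (⌈t⌉₊ + 1) t := hag _ _ _ ht0 (Nat.le_ceil t) hlt.le
  simp only [he]
  exact (hU (⌈t⌉₊ + 1) t ⟨ht0, hlt.le⟩).congr_of_eventuallyEq hev he

end SolvesOn

end GenericODE

/-! ### Monotonicity and limits on the half-line. -/

theorem monotoneOn_of_hasDerivWithinAt_Ici {f f' : ℝ → ℝ} {s : Set ℝ} (hs : Convex ℝ s)
    (h0 : s ⊆ Ici 0) (hf : ∀ t ∈ s, HasDerivWithinAt f (f' t) (Ici 0) t)
    (hf' : ∀ t ∈ s, 0 ≤ f' t) : MonotoneOn f s :=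
  monotoneOn_of_hasDerivWithinAt_nonneg hs (fun t ht => (hf t ht).continuousWithinAt.mono h0)
    (fun t ht => (hf t (interior_subset ht)).mono (interior_subset.trans h0))
    (fun t ht => hf' t (interior_subset ht))

theorem antitoneOn_of_hasDerivWithinAt_Ici {f f' : ℝ → ℝ} {s : Set ℝ} (hs : Convex ℝ s)
    (h0 : s ⊆ Ici 0) (hf : ∀ t ∈ s, HasDerivWithinAt f (f' t) (Ici 0) t)
    (hf' : ∀ t ∈ s, f' t ≤ 0) : AntitoneOn f s :=
  antitoneOn_of_hasDerivWithinAt_nonpos hs (fun t ht => (hf t ht).continuousWithinAt.mono h0)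
    (fun t ht => (hf t (interior_subset ht)).mono (interior_subset.trans h0))
    (fun t ht => hf' t (interior_subset ht))

/-- A linear differential inequality `c z ≤ z'` propagates the sign of `z` forward. -/
theorem exists_pos_mul_le_of_linear_le {c z z' : ℝ → ℝ} {r T : ℝ} (hr : 0 ≤ r) (hrT : r ≤ T)
    (hc : ContinuousOn c (Icc r T)) (hz : ∀ t ∈ Icc r T, HasDerivWithinAt z (z' t) (Ici 0) t)
    (hle : ∀ t ∈ Icc r T, c t * z t ≤ z' t) : ∃ κ > 0, z r * κ ≤ z T := by
  -- Extending `c` continuously to the line makes its primitive `F` differentiable everywhere; `exp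
  -- (-F)` is the integrating factor.
  set C := IccExtend hrT (domRestrict (Icc r T) c) with hC
  have hCc : Continuous C := (continuousOn_iff_continuous_domRestrict.1 hc).Icc_extend'
  have hCe : ∀ t ∈ Icc r T, C t = c t := fun t ht => IccExtend_of_mem hrT _ ht
  set F : ℝ → ℝ := fun t => ∫ s in r..t, C s with hF
  have hFd : ∀ t, HasDerivAt F (C t) t := fun t => (hCc.integral_hasStrictDerivAt r t).hasDerivAt
  have hm : MonotoneOn (fun t => z t * Real.exp (-F t)) (Icc r T) := by
    refine monotoneOn_of_hasDerivWithinAt_Ici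
      (f' := fun t => z' t * Real.exp (-F t) + z t * (Real.exp (-F t) * -C t)) (convex_Icc _ _)
      (fun t ht => hr.trans ht.1)
      (fun t ht => (hz t ht).mul ((hFd t).neg.exp.hasDerivWithinAt)) fun t ht => ?_
    have h1 := hle t ht
    rw [← hCe t ht] at h1
    have h2 : 0 ≤ (z' t - C t * z t) * Real.exp (-F t) :=
      mul_nonneg (by linarith) (Real.exp_pos _).le
    linarith
  have h1 := hm ⟨le_rfl, hrT⟩ ⟨hrT, le_rfl⟩ hrT
  have h2 : F r = 0 := by simp [hF]
  simp only [h2, neg_zero, Real.exp_zero, mul_one] at h1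
  refine ⟨Real.exp (F T), Real.exp_pos _, ?_⟩
  calc z r * Real.exp (F T) ≤ z T * Real.exp (-F T) * Real.exp (F T) := by gcongr
    _ = z T := by rw [mul_assoc, ← Real.exp_add]; simp

theorem MonotoneOn.exists_tendsto_atTop {f : ℝ → ℝ} (hf : MonotoneOn f (Ici 0)) {M : ℝ}
    (hM : ∀ t, 0 ≤ t → f t ≤ M) :
    ∃ l, Tendsto f atTop (𝓝 l) ∧ ∀ t, 0 ≤ t → f t ≤ l := by
  have hg : Monotone fun t => f (max t 0) := fun s t h =>
    hf (mem_Ici.2 (le_max_right _ _)) (mem_Ici.2 (le_max_right _ _)) (max_le_max_right 0 h)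
  have hb : BddAbove (range fun t => f (max t 0)) :=
    ⟨M, by rintro _ ⟨t, rfl⟩; exact hM _ (le_max_right _ _)⟩
  refine ⟨_, (tendsto_atTop_ciSup hg hb).congr' ?_, fun t ht => ?_⟩
  · filter_upwards [eventually_ge_atTop 0] with t ht
    rw [max_eq_left ht]
  · simpa [max_eq_left ht] using le_ciSup hb t

theorem MonotoneOn.le_of_tendsto_atTop {f : ℝ → ℝ} (hf : MonotoneOn f (Ici 0)) {l : ℝ}
    (hl : Tendsto f atTop (𝓝 l)) {t : ℝ} (ht : 0 ≤ t) : f t ≤ l :=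
  ge_of_tendsto hl ((eventually_ge_atTop t).mono fun _ hs => hf ht (ht.trans hs) hs)

theorem AntitoneOn.ge_of_tendsto_atTop {f : ℝ → ℝ} (hf : AntitoneOn f (Ici 0)) {l : ℝ}
    (hl : Tendsto f atTop (𝓝 l)) {t : ℝ} (ht : 0 ≤ t) : l ≤ f t :=
  le_of_tendsto hl ((eventually_ge_atTop t).mono fun _ hs => hf ht (ht.trans hs) hs)

theorem ContinuousOn.le_of_forall_mem_Ico {f : ℝ → ℝ} {s c : ℝ} (hs : 0 < s)
    (hf : ContinuousOn f (Icc 0 s)) (h : ∀ t ∈ Ico 0 s, f t ≤ c) : f s ≤ c := by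
  have hc : Tendsto f (𝓝[Ico 0 s] s) (𝓝 (f s)) :=
    (hf s ⟨hs.le, le_rfl⟩).mono Ico_subset_Icc_self
  have : (𝓝[Ico 0 s] s).NeBot := by
    rw [← mem_closure_iff_nhdsWithin_neBot, closure_Ico hs.ne]
    exact ⟨hs.le, le_rfl⟩
  exact le_of_tendsto hc (eventually_mem_nhdsWithin.mono h)

/-! ### The phase-space system and its monotone quantities. -/

/-- The first-order system for `(f, f', f'')` equivalent to
`f''' + a f f'' - b f' ^ 2 = 0`. -/
def layerField (a b : ℝ) (p : ℝ × ℝ × ℝ) : ℝ × ℝ × ℝ :=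
  (p.2.1, p.2.2, -(a * p.1 * p.2.2) + b * p.2.1 ^ 2)

/-- The quantity `f'' + a f f'`, which is monotone along trajectories. -/
def flux (a : ℝ) (p : ℝ × ℝ × ℝ) : ℝ := p.2.2 + a * p.1 * p.2.1

theorem continuous_flux (a : ℝ) : Continuous (flux a) := by
  unfold flux; fun_prop

/-- Precomposing the polynomial field with the coordinatewise clamp to `[-|R|, |R|]`, a 1-Lipschitz
map into a compact convex ball, gives the truncation. -/
theorem hasLipschitzTruncations_layerField (a b : ℝ) :
    HasLipschitzTruncations (layerField a b) := fun R => by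
  have hv : ContDiff ℝ 1 (layerField a b) := by unfold layerField; fun_prop
  set B := Metric.closedBall (0 : ℝ × ℝ × ℝ) |R|
  obtain ⟨K, hK⟩ := hv.contDiffOn.exists_lipschitzOnWith one_ne_zero (convex_closedBall _ _)
    (isCompact_closedBall (0 : ℝ × ℝ × ℝ) |R|)
  obtain ⟨L, hL⟩ := (isCompact_closedBall (0 : ℝ × ℝ × ℝ) |R|).exists_bound_of_continuousOn
    hv.continuous.continuousOn
  let c : ℝ → ℝ := fun x => projIcc (-|R|) |R| (by linarith [abs_nonneg R]) x
  have hc : LipschitzWith 1 c := LipschitzWith.projIcc _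
  have hcb : ∀ x, |c x| ≤ |R| := fun x => abs_le.2 (projIcc (-|R|) |R| _ x).2
  have hci : ∀ x, |x| ≤ |R| → c x = x := fun x hx => by
    simp [c, projIcc_of_mem _ (show x ∈ Icc (-|R|) |R| from abs_le.1 hx)]
  let r : ℝ × ℝ × ℝ → ℝ × ℝ × ℝ := fun p => (c p.1, c p.2.1, c p.2.2)
  have hr : LipschitzWith 1 r := by
    have h1 := hc.comp (LipschitzWith.prod_fst (α := ℝ) (β := ℝ × ℝ))
    have h2 := hc.comp ((LipschitzWith.prod_fst (α := ℝ) (β := ℝ)).comp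
      (LipschitzWith.prod_snd (α := ℝ) (β := ℝ × ℝ)))
    have h3 := hc.comp ((LipschitzWith.prod_snd (α := ℝ) (β := ℝ)).comp
      (LipschitzWith.prod_snd (α := ℝ) (β := ℝ × ℝ)))
    simpa using! h1.prodMk (h2.prodMk h3)
  have hrB : ∀ p, r p ∈ Metric.closedBall (0 : ℝ × ℝ × ℝ) |R| := fun p => by
    simp [Prod.norm_def, r, hcb]
  refine ⟨layerField a b ∘ r, K * 1, L.toNNReal, ?_, fun p => ?_, fun p hp => ?_⟩
  · exact lipschitzOnWith_univ.1
      (hK.comp hr.lipschitzOnWith fun p _ => hrB p)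
  · exact (hL _ (hrB p)).trans (Real.le_coe_toNNReal L)
  · have hp' : ‖p‖ ≤ |R| := hp.trans (le_abs_self R)
    simp only [Prod.norm_def, sup_le_iff, Real.norm_eq_abs] at hp'
    have : r p = p := by
      ext <;> simp [r, hci, hp'.1, hp'.2.1, hp'.2.2]
    simp [this]

namespace SolvesOn

variable {a b : ℝ} {u : ℝ → ℝ × ℝ × ℝ} {s : Set ℝ} {t T : ℝ}

theorem fst (h : SolvesOn (layerField a b) u s) (ht : t ∈ s) :
    HasDerivWithinAt (fun t => (u t).1) (u t).2.1 (Ici 0) t :=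
  (h t ht).fst

theorem snd (h : SolvesOn (layerField a b) u s) (ht : t ∈ s) :
    HasDerivWithinAt (fun t => (u t).2.1) (u t).2.2 (Ici 0) t :=
  (h t ht).snd.fst

theorem thd (h : SolvesOn (layerField a b) u s) (ht : t ∈ s) :
    HasDerivWithinAt (fun t => (u t).2.2) (-(a * (u t).1 * (u t).2.2) + b * (u t).2.1 ^ 2)
      (Ici 0) t :=
  (h t ht).snd.snd

theorem hasDerivWithinAt_flux (h : SolvesOn (layerField a b) u s) (ht : t ∈ s) :
    HasDerivWithinAt (fun t => flux a (u t)) ((a + b) * (u t).2.1 ^ 2) (Ici 0) t := by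
  refine ((h.thd ht).add (((h.fst ht).const_mul a).mul (h.snd ht))).congr_deriv ?_
  ring

theorem flux_monotoneOn (h : SolvesOn (layerField a b) u s) (hs : Convex ℝ s) (h0 : s ⊆ Ici 0)
    (hab : 0 ≤ a + b) : MonotoneOn (fun t => flux a (u t)) s :=
  monotoneOn_of_hasDerivWithinAt_Ici hs h0 (fun _ ht => h.hasDerivWithinAt_flux ht) fun _ _ => by positivity

theorem snd_antitoneOn (h : SolvesOn (layerField a b) u s) (hs : Convex ℝ s) (h0 : s ⊆ Ici 0)
    (hz : ∀ t ∈ s, (u t).2.2 ≤ 0) : AntitoneOn (fun t => (u t).2.1) s :=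
  antitoneOn_of_hasDerivWithinAt_Ici hs h0 (fun _ ht => h.snd ht) hz

theorem fst_monotoneOn (h : SolvesOn (layerField a b) u s) (hs : Convex ℝ s) (h0 : s ⊆ Ici 0)
    (hy : ∀ t ∈ s, 0 ≤ (u t).2.1) : MonotoneOn (fun t => (u t).1) s :=
  monotoneOn_of_hasDerivWithinAt_Ici hs h0 (fun _ ht => h.fst ht) hy

/-- The derivative of f' + (a/2) f² is exactly the flux. With f' ≥ 0 this bounds f independently of
time. -/
theorem potential_antitoneOn (h : SolvesOn (layerField a b) u s) (hs : Convex ℝ s)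
    (h0 : s ⊆ Ici 0) (hH : ∀ t ∈ s, flux a (u t) ≤ 0) :
    AntitoneOn (fun t => (u t).2.1 + a / 2 * (u t).1 ^ 2) s :=
  antitoneOn_of_hasDerivWithinAt_Ici hs h0 (f' := fun t => flux a (u t))
    (fun t ht => ((h.snd ht).add (((h.fst ht).pow 2).const_mul (a / 2))).congr_deriv
      (by simp only [flux]; ring)) hH

/-- Since f''' + a f f'' = b f'² ≥ 0, an integrating factor preserves the sign of f''. -/
theorem thd_pos (h : SolvesOn (layerField a b) u (Icc 0 T)) (hb : 0 ≤ b) {r : ℝ}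
    (hr : r ∈ Icc 0 T) (hz : 0 < (u r).2.2) : ∀ t ∈ Icc r T, 0 < (u t).2.2 := fun t ht => by
  have hsub : Icc r t ⊆ Icc 0 T := Icc_subset_Icc hr.1 ht.2
  obtain ⟨κ, hκ, hle⟩ := exists_pos_mul_le_of_linear_le (c := fun t => -(a * (u t).1)) hr.1 ht.1
    (((h.continuousOn Icc_subset_Ici_self).mono hsub).fst.const_smul a).neg
    (fun q hq => h.thd (hsub hq)) (fun q _ => by nlinarith [sq_nonneg (u q).2.1])
  exact (mul_pos hz hκ).trans_le hle

/-- Points with f' = f'' = 0 are equilibria, and backward uniqueness keeps a nonconstant trajectory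
from reaching one. -/
theorem thd_ne_zero (h : SolvesOn (layerField a b) u (Icc 0 T)) (hT : 0 ≤ T) (h0 : (u 0).2.1 ≠ 0)
    (hy : (u T).2.1 = 0) : (u T).2.2 ≠ 0 := fun hz => by
  have hc : SolvesOn (layerField a b) (fun _ => u T) (Icc 0 T) := fun t _ => by
    have : layerField a b (u T) = 0 := by simp [layerField, hy, hz]
    rw [this]
    exact hasDerivWithinAt_const _ _ _
  have := h.eqOn_of_eq_right (hasLipschitzTruncations_layerField a b) hc rfl ⟨le_rfl, hT⟩
  exact h0 (by rw [this, hy])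

end SolvesOn

/-! ### Shooting in the initial slope. -/

/-- Initial slopes whose trajectory reaches a negative slope with negative flux. -/
def undershoots (a b γ : ℝ) : Set ℝ :=
  {α | ∃ T, 0 ≤ T ∧ ∃ u : ℝ → ℝ × ℝ × ℝ, u 0 = (-γ, α, -1) ∧
    SolvesOn (layerField a b) u (Icc 0 T) ∧ (u T).2.1 < 0 ∧ flux a (u T) < 0}

/-- Initial slopes whose trajectory reaches a positive flux or positive second derivative before
the slope vanishes. -/
def overshoots (a b γ : ℝ) : Set ℝ :=
  {α | ∃ T, 0 ≤ T ∧ ∃ u : ℝ → ℝ × ℝ × ℝ, u 0 = (-γ, α, -1) ∧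
    SolvesOn (layerField a b) u (Icc 0 T) ∧ (∀ t ∈ Icc 0 T, 0 < (u t).2.1) ∧
    (0 < flux a (u T) ∨ 0 < (u T).2.2)}

section Shooting

variable {a b γ α T : ℝ} {u : ℝ → ℝ × ℝ × ℝ}

theorem exists_near_of_slope (hT : 0 ≤ T) (h0 : u 0 = (-γ, α, -1))
    (hu : SolvesOn (layerField a b) u (Icc 0 T)) {ε : ℝ} (hε : 0 < ε) :
    ∀ᶠ β in 𝓝 α, ∃ u' : ℝ → ℝ × ℝ × ℝ, u' 0 = (-γ, β, -1) ∧
      SolvesOn (layerField a b) u' (Icc 0 T) ∧ ∀ t ∈ Icc 0 T, dist (u' t) (u t) < ε := by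
  obtain ⟨δ, hδ, h⟩ := hu.exists_near (hasLipschitzTruncations_layerField a b) hT hε
  refine Metric.eventually_nhds_iff.2 ⟨δ, hδ, fun β hβ => h (-γ, β, -1) ?_⟩
  simpa [h0, Prod.dist_eq] using hβ

theorem isOpen_undershoots : IsOpen (undershoots a b γ) := by
  rw [isOpen_iff_mem_nhds]
  rintro α ⟨T, hT, u, h0, hu, hy, hH⟩
  have hev : ∀ᶠ p in 𝓝 (u T), p.2.1 < 0 ∧ flux a p < 0 :=
    ((by fun_prop : Continuous fun p : ℝ × ℝ × ℝ => p.2.1).continuousAt.eventually_lt_const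
      hy).and ((continuous_flux a).continuousAt.eventually_lt_const hH)
  obtain ⟨ε, hε, h⟩ := Metric.eventually_nhds_iff.1 hev
  filter_upwards [exists_near_of_slope hT h0 hu hε] with β ⟨u', h0', hu', hd⟩
  exact ⟨T, hT, u', h0', hu', h (hd T ⟨hT, le_rfl⟩)⟩

/-- Positivity of the slope on all of `[0, T]` survives perturbation because its minimum there is
attained, hence positive. -/
theorem isOpen_overshoots : IsOpen (overshoots a b γ) := by
  rw [isOpen_iff_mem_nhds]
  rintro α ⟨T, hT, u, h0, hu, hy, hH⟩
  have hev : ∀ᶠ p in 𝓝 (u T), 0 < flux a p ∨ 0 < p.2.2 := by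
    rcases hH with hH | hH
    · exact ((continuous_flux a).continuousAt.eventually_const_lt hH).mono fun _ => Or.inl
    · exact ((by fun_prop : Continuous fun p : ℝ × ℝ × ℝ =>
        p.2.2).continuousAt.eventually_const_lt hH).mono fun _ => Or.inr
  obtain ⟨ε, hε, h⟩ := Metric.eventually_nhds_iff.1 hev
  obtain ⟨r, hr, hmin⟩ := isCompact_Icc.exists_isMinOn (nonempty_Icc.2 hT)
    (hu.continuousOn Icc_subset_Ici_self).snd.fst
  filter_upwards [exists_near_of_slope hT h0 hu (lt_min hε (hy r hr))] with β ⟨u', h0', hu', hd⟩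
  refine ⟨T, hT, u', h0', hu', fun t ht => ?_,
    h ((hd T ⟨hT, le_rfl⟩).trans_le (min_le_left _ _))⟩
  have h1 : (u r).2.1 ≤ (u t).2.1 := hmin ht
  have h2 : dist (u' t).2.1 (u t).2.1 < (u r).2.1 :=
    calc dist (u' t).2.1 (u t).2.1 ≤ dist (u' t).2 (u t).2 := le_max_left _ _
      _ ≤ dist (u' t) (u t) := le_max_right _ _
      _ < _ := (hd t ht).trans_le (min_le_right _ _)
  rw [Real.dist_eq, abs_lt] at h2
  linarith

/-- If the overshoot comes first, either the flux stays positive by monotonicity, or f'' stays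
positive and f' keeps growing; neither permits a later undershoot. -/
theorem disjoint_undershoots_overshoots (hb : 0 ≤ b) (hab : 0 ≤ a + b) :
    Disjoint (undershoots a b γ) (overshoots a b γ) := by
  rw [Set.disjoint_left]
  rintro α ⟨T, hT, u, h0, hu, hy, hH⟩ ⟨S, hS, w, hw0, hw, hwy, hwH⟩
  have hv := hasLipschitzTruncations_layerField a b
  have h0' : u 0 = w 0 := h0.trans hw0.symm
  rcases le_total T S with h | h
  · have := hu.eqOn hv (hw.mono (Icc_subset_Icc_right h)) h0' ⟨hT, le_rfl⟩
    rw [this] at hy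
    linarith [hwy T ⟨hT, h⟩]
  · have heq := (hu.mono (Icc_subset_Icc_right h)).eqOn hv hw h0'
    rw [← heq ⟨hS, le_rfl⟩] at hwH
    rcases hwH with hwH | hwH
    · have := hu.flux_monotoneOn (convex_Icc _ _) Icc_subset_Ici_self hab ⟨hS, h⟩ ⟨hT, le_rfl⟩ h
      simp only at this
      linarith
    · have hpos := hu.thd_pos hb ⟨hS, h⟩ hwH
      have hmono : MonotoneOn (fun t => (u t).2.1) (Icc S T) :=
        monotoneOn_of_hasDerivWithinAt_Ici (convex_Icc _ _) (fun t ht => hS.trans ht.1)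
          (fun t ht => hu.snd ⟨hS.trans ht.1, ht.2⟩) fun t ht => (hpos t ht).le
      have h1 := hmono ⟨le_rfl, h⟩ ⟨h, le_rfl⟩ h
      have h2 := hwy S ⟨hS, le_rfl⟩
      rw [← heq ⟨hS, le_rfl⟩] at h2
      simp only at h1
      linarith

/-- Where f' = 0 the flux equals f'' < 0; continuing slightly past `T` makes f' negative while the
flux is still negative. -/
theorem mem_undershoots_of_slope_eq_zero (hT : 0 ≤ T) (h0 : u 0 = (-γ, α, -1))
    (hu : SolvesOn (layerField a b) u (Icc 0 T)) (hy : (u T).2.1 = 0) (hz : (u T).2.2 < 0) :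
    α ∈ undershoots a b γ := by
  obtain ⟨T', hT', w, hw, heq⟩ :=
    hu.exists_extension (hasLipschitzTruncations_layerField a b) hT
  rw [← heq ⟨hT, le_rfl⟩] at hy hz
  have hev : ∀ᶠ p in 𝓝 (w T), p.2.2 < 0 ∧ flux a p < 0 :=
    ((by fun_prop : Continuous fun p : ℝ × ℝ × ℝ => p.2.2).continuousAt.eventually_lt_const
      hz).and ((continuous_flux a).continuousAt.eventually_lt_const (by simpa [flux, hy] using hz))
  have hev' := (hw.hasDerivWithinAt_Ici ⟨hT, hT'.le⟩).continuousWithinAt.eventually hev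
  obtain ⟨r, hr, hsub⟩ := mem_nhdsGE_iff_exists_Icc_subset.1 hev'
  have hTr : T < min r T' := lt_min hr hT'
  have hanti : StrictAntiOn (fun t => (w t).2.1) (Icc T (min r T')) := by
    have hmem : ∀ t ∈ Icc T (min r T'), t ∈ Icc 0 T' := fun t ht =>
      ⟨hT.trans ht.1, ht.2.trans (min_le_right _ _)⟩
    refine strictAntiOn_of_hasDerivWithinAt_neg (convex_Icc _ _)
      (((hw.continuousOn Icc_subset_Ici_self).mono hmem).snd.fst)
      (fun t ht => (hw.snd (hmem t (interior_subset ht))).mono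
        fun q hq => (hmem q (interior_subset hq)).1) fun t ht => ?_
    have ht' := interior_subset ht
    exact (hsub ⟨ht'.1, ht'.2.trans (min_le_left _ _)⟩).1
  have hneg := hanti ⟨le_rfl, hTr.le⟩ ⟨hTr.le, le_rfl⟩ hTr
  simp only [hy] at hneg
  exact ⟨min r T', hT.trans hTr.le, w, (heq ⟨le_rfl, hT⟩).trans h0,
    hw.mono (Icc_subset_Icc_right (min_le_right _ _)), hneg,
    (hsub ⟨hTr.le, min_le_left _ _⟩).2⟩

theorem zero_mem_undershoots : (0 : ℝ) ∈ undershoots a b γ := by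
  obtain ⟨w, K, L, hK, hL, hw⟩ := hasLipschitzTruncations_layerField a b ‖((-γ, 0, -1) : ℝ × ℝ × ℝ)‖
  obtain ⟨u, h0, hu⟩ := SolvesOn.exists_of_lipschitz_of_bounded hK hL (-γ, 0, -1) le_rfl
  have hu' : SolvesOn (layerField a b) u (Icc 0 0) := hu.congr_field fun t ht => hw _ (by
    rw [Icc_self, mem_singleton_iff] at ht
    rw [ht, h0])
  exact mem_undershoots_of_slope_eq_zero le_rfl h0 hu' (by simp [h0]) (by simp [h0])

theorem thd_nonpos_and_flux_nonpos_of_notMem_overshoots (hB : α ∉ overshoots a b γ)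
    (h0 : u 0 = (-γ, α, -1)) (hu : SolvesOn (layerField a b) u (Icc 0 T))
    (hy : ∀ t ∈ Ico 0 T, 0 < (u t).2.1) (hT : 0 < T) :
    ∀ t ∈ Icc 0 T, (u t).2.2 ≤ 0 ∧ flux a (u t) ≤ 0 := by
  have hlt : ∀ t ∈ Ico 0 T, (u t).2.2 ≤ 0 ∧ flux a (u t) ≤ 0 := fun t ht => by
    by_contra hcon
    refine hB ⟨t, ht.1, u, h0, hu.mono (Icc_subset_Icc_right ht.2.le),
      fun s hs => hy s ⟨hs.1, hs.2.trans_lt ht.2⟩, ?_⟩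
    by_contra! hcon'
    exact hcon ⟨hcon'.2, hcon'.1⟩
  have hc := hu.continuousOn Icc_subset_Ici_self
  intro t ht
  rcases ht.2.eq_or_lt with rfl | h
  · exact ⟨ContinuousOn.le_of_forall_mem_Ico hT hc.snd.snd fun s hs => (hlt s hs).1,
      ContinuousOn.le_of_forall_mem_Ico (f := fun t => flux a (u t)) hT
        ((continuous_flux a).comp_continuousOn hc)
        fun s hs => (hlt s hs).2⟩
  · exact hlt t ⟨ht.1, h⟩

/-- At a first zero of f', not overshooting gives f'' ≤ 0, and f'' = 0 is excluded as an
equilibrium, so the slope would undershoot. -/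
theorem trapped_of_notMem (hα : 0 < α) (hA : α ∉ undershoots a b γ)
    (hB : α ∉ overshoots a b γ) (hT : 0 ≤ T) (h0 : u 0 = (-γ, α, -1))
    (hu : SolvesOn (layerField a b) u (Icc 0 T)) :
    0 < (u T).2.1 ∧ (u T).2.2 ≤ 0 ∧ flux a (u T) ≤ 0 := by
  have hpos : ∀ S ∈ Icc 0 T, 0 < (u S).2.1 := by
    intro S hS
    by_contra! hle
    have huS := hu.mono (Icc_subset_Icc_right hS.2)
    obtain ⟨s, hs, hs0, hlt⟩ := exists_first_zero hS.1
      (huS.continuousOn Icc_subset_Ici_self).snd.fst (by simpa [h0] using hα) hle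
    have hus := huS.mono (Icc_subset_Icc_right hs.2)
    have hz := (thd_nonpos_and_flux_nonpos_of_notMem_overshoots hB h0 hus hlt hs.1 s
      ⟨hs.1.le, le_rfl⟩).1
    have hz' := hus.thd_ne_zero hs.1.le (by simpa [h0] using hα.ne') hs0
    exact hA (mem_undershoots_of_slope_eq_zero hs.1.le h0 hus hs0 (lt_of_le_of_ne hz hz'))
  refine ⟨hpos T ⟨hT, le_rfl⟩, ?_⟩
  by_contra hcon
  refine hB ⟨T, hT, u, h0, hu, hpos, ?_⟩
  by_contra! hcon'
  exact hcon ⟨hcon'.2, hcon'.1⟩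

theorem exists_global_of_notMem (ha : 0 < a) (hb : 0 ≤ b) (hα : 0 < α)
    (hA : α ∉ undershoots a b γ) (hB : α ∉ overshoots a b γ) :
    ∃ u : ℝ → ℝ × ℝ × ℝ, u 0 = (-γ, α, -1) ∧ SolvesOn (layerField a b) u (Ici 0) ∧
      ∀ t, 0 ≤ t → 0 < (u t).2.1 ∧ (u t).2.2 ≤ 0 ∧ flux a (u t) ≤ 0 := by
  -- A priori bounds: the potential bounds f² and |x| ≤ 1 + x² gives |f| ≤ `M`; f' stays in (0, α];
  -- f'' is the flux minus a f f', with the flux at least its initial value, whence `Z`.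
  set M := 1 + (γ ^ 2 + 2 * α / a) with hM
  have hM0 : 0 ≤ M := by positivity
  have hMγ : |γ| ≤ M := by
    have : |γ| ≤ 1 + γ ^ 2 := by rw [← sq_abs γ]; nlinarith [sq_nonneg (|γ| - 1), abs_nonneg γ]
    have : 0 ≤ 2 * α / a := by positivity
    linarith
  set Z := |(-1) - a * γ * α| + a * M * α with hZ
  have hZ0 : 0 ≤ a * M * α := by positivity
  have hR0 : ‖((-γ, α, -1) : ℝ × ℝ × ℝ)‖ < M + α + Z + 2 := by
    have : 0 ≤ Z := by positivity
    simp only [Prod.norm_def, Real.norm_eq_abs, abs_neg, abs_one, sup_lt_iff, abs_of_pos hα]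
    refine ⟨by linarith, by linarith, by linarith⟩
  obtain ⟨u, h0, hu⟩ := SolvesOn.exists_global (hasLipschitzTruncations_layerField a b) hR0 (by
    intro T hT u h0 hu
    have htr : ∀ t ∈ Icc 0 T, _ := fun t ht => trapped_of_notMem hα hA hB ht.1 h0
      (hu.mono (Icc_subset_Icc_right ht.2))
    have hl : (0 : ℝ) ∈ Icc 0 T := ⟨le_rfl, hT⟩
    have hr : T ∈ Icc 0 T := ⟨hT, le_rfl⟩
    have hy := hu.snd_antitoneOn (convex_Icc _ _) Icc_subset_Ici_self (fun t ht => (htr t ht).2.1)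
      hl hr hT
    have hG := hu.potential_antitoneOn (convex_Icc _ _) Icc_subset_Ici_self
      (fun t ht => (htr t ht).2.2) hl hr hT
    have hF := hu.flux_monotoneOn (convex_Icc _ _) Icc_subset_Ici_self (by linarith) hl hr hT
    obtain ⟨hy0, hz0, hF0⟩ := htr T hr
    simp only [h0] at hy hG hF
    have hx : (u T).1 ^ 2 ≤ γ ^ 2 + 2 * α / a := by
      have : a / 2 * (u T).1 ^ 2 ≤ a / 2 * (γ ^ 2 + 2 * α / a) := by
        have : a / 2 * (γ ^ 2 + 2 * α / a) = α + a / 2 * (-γ) ^ 2 := by field_simp; ring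
        linarith
      exact le_of_mul_le_mul_left this (by positivity)
    have hxM : |(u T).1| ≤ M := by
      rw [← sq_abs] at hx
      nlinarith [sq_nonneg (|(u T).1| - 1), abs_nonneg (u T).1]
    have hxy : |a * (u T).1 * (u T).2.1| ≤ a * M * α := by
      rw [abs_mul, abs_mul, abs_of_pos ha, abs_of_pos hy0]
      gcongr
    have hzZ : |(u T).2.2| ≤ Z := by
      have h1 : flux a (-γ, α, -1) = -1 - a * γ * α := by simp [flux]; ring
      have h2 : flux a (u T) = (u T).2.2 + a * (u T).1 * (u T).2.1 := rfl
      rw [h1] at hF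
      have := neg_abs_le (-1 - a * γ * α)
      rw [abs_le] at hxy ⊢
      constructor <;> linarith [abs_nonneg (-1 - a * γ * α)]
    have : 0 ≤ Z := by positivity
    simp only [Prod.norm_def, Real.norm_eq_abs, sup_lt_iff, abs_of_pos hy0]
    refine ⟨by linarith, by linarith, by linarith⟩)
  exact ⟨u, h0, hu, fun t ht => trapped_of_notMem hα hA hB ht h0 (hu.mono Icc_subset_Ici_self)⟩

/-- For steep initial slopes the trajectory leaves the trapping region quickly, and not through
`f' = 0`. -/
theorem slope_pos_and_time_lt_of_steep (ha : 1 < a) (hb : 0 ≤ b) {C M S : ℝ}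
    (hC : C = 4 * (|γ| + 1)) (hM : M = 1 + a * (2 * |γ| + C)) (hα : 1 ≤ α) (hαM : 2 * (M * C) ≤ α)
    (hS : 0 ≤ S) (h0 : u 0 = (-γ, α, -1)) (hu : SolvesOn (layerField a b) u (Icc 0 S))
    (hy : ∀ t ∈ Icc 0 S, 0 ≤ (u t).2.1) (hz : ∀ t ∈ Icc 0 S, (u t).2.2 ≤ 0)
    (hF : flux a (u S) ≤ 0) :
    0 < (u S).2.1 ∧ S < C / α := by
  have hg := abs_nonneg γ
  have hC0 : 0 < C := by rw [hC]; positivity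
  have hyle : ∀ t ∈ Icc 0 S, (u t).2.1 ≤ α := fun t ht => by
    have := hu.snd_antitoneOn (convex_Icc _ _) Icc_subset_Ici_self hz ⟨le_rfl, hS⟩ ht ht.1
    simpa [h0] using this
  have hxge : ∀ t ∈ Icc 0 S, -γ ≤ (u t).1 := fun t ht => by
    have := hu.fst_monotoneOn (convex_Icc _ _) Icc_subset_Ici_self hy ⟨le_rfl, hS⟩ ht ht.1
    simpa [h0] using this
  have hxle : ∀ t ∈ Icc 0 S, (u t).1 ≤ -γ + α * t := fun t ht => by
    have := antitoneOn_of_hasDerivWithinAt_Ici (f := fun t => (u t).1 - α * t)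
      (f' := fun t => (u t).2.1 - α * 1) (convex_Icc 0 S) Icc_subset_Ici_self
      (fun t ht => (hu.fst ht).sub ((hasDerivWithinAt_id t _).const_mul α))
      (fun t ht => by linarith [hyle t ht]) ⟨le_rfl, hS⟩ ht ht.1
    simp only [h0] at this
    linarith
  have hFge : ∀ t ∈ Icc 0 S, -1 - a * |γ| * α ≤ flux a (u t) := fun t ht => by
    have h1 := hu.flux_monotoneOn (convex_Icc _ _) Icc_subset_Ici_self (by linarith)
      ⟨le_rfl, hS⟩ ht ht.1
    simp only [h0, flux] at h1
    have : a * α * γ ≤ a * α * |γ| := by gcongr; exact le_abs_self γ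
    simp only [flux]
    linarith
  -- While αt ≤ C one has f ≤ |γ| + C, so f'' ≥ -Mα and f' loses at most MC ≤ α/2.
  have hhalf : ∀ t ∈ Icc 0 S, α * t ≤ C → α / 2 ≤ (u t).2.1 := fun t ht htC => by
    have hsub : Icc 0 t ⊆ Icc 0 S := Icc_subset_Icc_right ht.2
    have := monotoneOn_of_hasDerivWithinAt_Ici (f := fun t => (u t).2.1 + M * α * t)
      (f' := fun t => (u t).2.2 + M * α * 1) (convex_Icc 0 t) Icc_subset_Ici_self
      (fun s hs => (hu.snd (hsub hs)).add ((hasDerivWithinAt_id s _).const_mul (M * α)))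
      (fun s hs => by
        have h1 := hFge s (hsub hs)
        have h2 : (u s).1 ≤ |γ| + C := by
          have : α * s ≤ α * t := by gcongr; exact hs.2
          linarith [hxle s (hsub hs), neg_abs_le γ]
        have h3 : a * (u s).1 * (u s).2.1 ≤ a * (|γ| + C) * α :=
          calc a * (u s).1 * (u s).2.1 ≤ a * (|γ| + C) * (u s).2.1 := by
                gcongr
                exact hy s (hsub hs)
            _ ≤ _ := by
                gcongr
                exact hyle s (hsub hs)
        simp only [flux] at h1
        have h4 : M * α = α + a * |γ| * α + a * (|γ| + C) * α := by rw [hM]; ring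
        linarith)
      ⟨le_rfl, ht.1⟩ ⟨ht.1, le_rfl⟩ ht.1
    simp only [h0] at this
    have hM0 : 0 ≤ M := by rw [hM]; positivity
    have : M * (α * t) ≤ M * C := by gcongr
    linarith
  -- With f' ≥ α/2 the flux gains (a + b)(α/2)² C/α = (a + b)(|γ| + 1)α by time C/α. `C` is chosen
  -- so that this beats the initial deficit 1 + a|γ|α, using a > 1 and α ≥ 1.
  have hSlt : S < C / α := by
    by_contra! hle
    have hc0 : 0 ≤ C / α := by positivity
    have hmem : Icc 0 (C / α) ⊆ Icc 0 S := Icc_subset_Icc_right hle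
    have h1 := monotoneOn_of_hasDerivWithinAt_Ici
      (f := fun t => flux a (u t) - (a + b) * (α / 2) ^ 2 * t)
      (f' := fun t => (a + b) * (u t).2.1 ^ 2 - (a + b) * (α / 2) ^ 2 * 1)
      (convex_Icc 0 (C / α)) Icc_subset_Ici_self
      (fun t ht => (hu.hasDerivWithinAt_flux (hmem ht)).sub
        ((hasDerivWithinAt_id t _).const_mul ((a + b) * (α / 2) ^ 2)))
      (fun t ht => by
        have h2 : α * t ≤ C := by
          have := ht.2
          rw [le_div_iff₀ (by linarith)] at this
          linarith
        have : (α / 2) ^ 2 ≤ (u t).2.1 ^ 2 := by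
          gcongr
          exact hhalf t (hmem ht) h2
        nlinarith)
      ⟨le_rfl, hc0⟩ ⟨hc0, le_rfl⟩ hc0
    have h2 := hu.flux_monotoneOn (convex_Icc _ _) Icc_subset_Ici_self (by linarith)
      ⟨hc0, hle⟩ ⟨hS, le_rfl⟩ hle
    have h3 := hFge 0 ⟨le_rfl, hS⟩
    simp only at h1 h2
    have h4 : (a + b) * (α / 2) ^ 2 * (C / α) = (a + b) * (|γ| + 1) * α := by
      rw [hC]; field_simp; ring
    have h5 : a * (|γ| + 1) * α ≤ (a + b) * (|γ| + 1) * α := by gcongr; linarith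
    nlinarith
  refine ⟨?_, hSlt⟩
  have := hhalf S ⟨hS, le_rfl⟩ (by
    rw [lt_div_iff₀ (by linarith)] at hSlt
    linarith)
  linarith

theorem exists_mem_overshoots (ha : 1 < a) (hb : 0 ≤ b) : ∃ α > 0, α ∈ overshoots a b γ := by
  obtain ⟨C, hC⟩ : ∃ C, C = 4 * (|γ| + 1) := ⟨_, rfl⟩
  obtain ⟨M, hM⟩ : ∃ M, M = 1 + a * (2 * |γ| + C) := ⟨_, rfl⟩
  set α := max 1 (2 * (M * C)) with hα
  have h1 : 1 ≤ α := le_max_left _ _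
  have h2 : 2 * (M * C) ≤ α := le_max_right _ _
  have hα0 : 0 < α := by linarith
  refine ⟨α, hα0, ?_⟩
  by_contra hB
  by_cases hA : α ∈ undershoots a b γ
  · obtain ⟨T, hT, u, h0, hu, hy, -⟩ := hA
    obtain ⟨s, hs, hs0, hlt⟩ := exists_first_zero hT
      (hu.continuousOn Icc_subset_Ici_self).snd.fst (by simpa [h0] using hα0) hy.le
    have hus := hu.mono (Icc_subset_Icc_right hs.2)
    have hz := thd_nonpos_and_flux_nonpos_of_notMem_overshoots hB h0 hus hlt hs.1
    have := (slope_pos_and_time_lt_of_steep ha hb hC hM h1 h2 hs.1.le h0 hus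
      (fun t ht => by
        rcases ht.2.eq_or_lt with rfl | h
        · exact hs0.ge
        · exact (hlt t ⟨ht.1, h⟩).le)
      (fun t ht => (hz t ht).1) (hz s ⟨hs.1.le, le_rfl⟩).2).1
    linarith
  · obtain ⟨u, h0, hu, htr⟩ := exists_global_of_notMem (by linarith) hb hα0 hA hB
    have hS : 0 ≤ C / α := by rw [hC]; positivity
    exact lt_irrefl _ (slope_pos_and_time_lt_of_steep ha hb hC hM h1 h2 hS h0
      (hu.mono Icc_subset_Ici_self) (fun t ht => (htr t ht.1).1.le) (fun t ht => (htr t ht.1).2.1)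
      (htr _ hS).2.2).2

/-- The shooting argument. -/
theorem exists_trapped_solution (γ : ℝ) (ha : 1 < a) (hb : 0 ≤ b) :
    ∃ α > 0, ∃ u : ℝ → ℝ × ℝ × ℝ, u 0 = (-γ, α, -1) ∧ SolvesOn (layerField a b) u (Ici 0) ∧
      ∀ t, 0 ≤ t → 0 < (u t).2.1 ∧ (u t).2.2 ≤ 0 ∧ flux a (u t) ≤ 0 := by
  obtain ⟨β, hβ, hβB⟩ := exists_mem_overshoots (γ := γ) ha hb
  have hdisj := disjoint_undershoots_overshoots (γ := γ) hb (by linarith : 0 ≤ a + b)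
  obtain ⟨α, hα, hn⟩ : ∃ α ∈ Icc 0 β, α ∉ undershoots a b γ ∪ overshoots a b γ := by
    by_contra! hcov
    obtain ⟨α, -, hα⟩ := isPreconnected_Icc _ _ isOpen_undershoots isOpen_overshoots hcov
      ⟨0, ⟨le_rfl, hβ.le⟩, zero_mem_undershoots⟩ ⟨β, ⟨hβ.le, le_rfl⟩, hβB⟩
    exact Set.disjoint_left.1 hdisj hα.1 hα.2
  rw [mem_union, not_or] at hn
  have hα0 : 0 < α := hα.1.lt_of_ne fun h => hn.1 (h ▸ zero_mem_undershoots)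
  exact ⟨α, hα0, exists_global_of_notMem (by linarith) hb hα0 hn.1 hn.2⟩

end Shooting

/-! ### Asymptotics of trapped trajectories. -/

section Trapped

variable {a b : ℝ} {u : ℝ → ℝ × ℝ × ℝ}

theorem SolvesOn.fst_sq_le (ha : 0 < a) (hu : SolvesOn (layerField a b) u (Ici 0))
    (hy : ∀ t, 0 ≤ t → 0 ≤ (u t).2.1) (hF : ∀ t, 0 ≤ t → flux a (u t) ≤ 0) {t : ℝ} (ht : 0 ≤ t) :
    (u t).1 ^ 2 ≤ (u 0).1 ^ 2 + 2 * (u 0).2.1 / a := by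
  have hG := hu.potential_antitoneOn (convex_Ici 0) subset_rfl hF self_mem_Ici ht ht
  simp only at hG
  have h1 : a / 2 * ((u 0).1 ^ 2 + 2 * (u 0).2.1 / a) = (u 0).2.1 + a / 2 * (u 0).1 ^ 2 := by
    field_simp
    ring
  have h2 := hy t ht
  exact le_of_mul_le_mul_left (a := a / 2) (by linarith) (by positivity)

theorem SolvesOn.fst_abs_le (ha : 0 < a) (hu : SolvesOn (layerField a b) u (Ici 0))
    (hy : ∀ t, 0 ≤ t → 0 ≤ (u t).2.1) (hF : ∀ t, 0 ≤ t → flux a (u t) ≤ 0) {t : ℝ} (ht : 0 ≤ t) :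
    |(u t).1| ≤ √((u 0).1 ^ 2 + 2 * (u 0).2.1 / a) :=
  Real.abs_le_sqrt (hu.fst_sq_le ha hy hF ht)

theorem SolvesOn.tendsto_snd (ha : 0 < a) (hu : SolvesOn (layerField a b) u (Ici 0))
    (hy : ∀ t, 0 ≤ t → 0 ≤ (u t).2.1) (hz : ∀ t, 0 ≤ t → (u t).2.2 ≤ 0)
    (hF : ∀ t, 0 ≤ t → flux a (u t) ≤ 0) : Tendsto (fun t => (u t).2.1) atTop (𝓝 0) := by
  have hanti := hu.snd_antitoneOn (convex_Ici 0) subset_rfl hz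
  obtain ⟨l, hl, -⟩ := hanti.neg.exists_tendsto_atTop (M := 0) fun t ht => by
    simpa using hy t ht
  have hl' : Tendsto (fun t => (u t).2.1) atTop (𝓝 (-l)) := by simpa using hl.neg
  have hle : ∀ t, 0 ≤ t → -l ≤ (u t).2.1 := fun t ht => hanti.ge_of_tendsto_atTop hl' ht
  have hl0 : 0 ≤ -l := ge_of_tendsto hl' ((eventually_ge_atTop 0).mono fun t ht => hy t ht)
  rcases hl0.eq_or_lt with h | h
  · rwa [← h] at hl'
  -- A positive limit of f' forces linear growth of f; by time (2M + 1)/(-l) this exceeds the width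
  -- 2M of the allowed range.
  · exfalso
    set M := √((u 0).1 ^ 2 + 2 * (u 0).2.1 / a)
    have hlin := monotoneOn_of_hasDerivWithinAt_Ici (f := fun t => (u t).1 - -l * t)
      (f' := fun t => (u t).2.1 - -l * 1) (convex_Ici 0) subset_rfl
      (fun t ht => (hu.fst ht).sub ((hasDerivWithinAt_id t _).const_mul (-l)))
      (fun t ht => by linarith [hle t ht])
    have hM0 : 0 ≤ M := Real.sqrt_nonneg _
    have hs : 0 ≤ (2 * M + 1) / -l := by positivity
    have h1 := hlin self_mem_Ici hs hs
    have h2 := hu.fst_abs_le ha hy hF hs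
    have h3 := hu.fst_abs_le ha hy hF le_rfl
    simp only [mul_div_cancel₀ _ h.ne', mul_zero, sub_zero] at h1
    rw [abs_le] at h2 h3
    linarith [h2.2, h3.1]

/-- Trapped solutions are eventually positive. The relation between the two coefficients excludes
decay to `0` from below. -/
theorem SolvesOn.eventually_pos (ha : 1 < a) (hb : b = 2 * a - 3) (hb0 : 0 ≤ b)
    (hu : SolvesOn (layerField a b) u (Ici 0))
    (hy : ∀ t, 0 ≤ t → 0 < (u t).2.1) (hz : ∀ t, 0 ≤ t → (u t).2.2 ≤ 0)
    (hF : ∀ t, 0 ≤ t → flux a (u t) ≤ 0) : ∀ᶠ t in atTop, 0 < (u t).1 := by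
  have ha0 : 0 < a := by linarith
  have hab : 0 < a + b := by linarith
  have hy' : ∀ t, 0 ≤ t → 0 ≤ (u t).2.1 := fun t ht => (hy t ht).le
  have hmono := hu.fst_monotoneOn (convex_Ici 0) subset_rfl hy'
  have hmono' : StrictMonoOn (fun t => (u t).1) (Ici 0) :=
    strictMonoOn_of_hasDerivWithinAt_pos (convex_Ici 0) (hu.continuousOn subset_rfl).fst
      (fun t ht => (hu.fst (interior_subset ht)).mono interior_subset)
      (fun t ht => hy t (interior_subset (s := Ici (0 : ℝ)) ht))
  have hy0 := hu.tendsto_snd ha0 hy' hz hF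
  by_contra hcon
  have hxle : ∀ t, 0 ≤ t → (u t).1 ≤ 0 := fun t ht => by
    by_contra! hpos
    exact hcon ((eventually_ge_atTop t).mono fun s hs => hpos.trans_le (hmono ht (ht.trans hs) hs))
  obtain ⟨l, hl, hxl⟩ := hmono.exists_tendsto_atTop hxle
  have hl0 : l ≤ 0 := le_of_tendsto hl ((eventually_ge_atTop 0).mono hxle)
  obtain ⟨h, hh, hFh⟩ := (hu.flux_monotoneOn (convex_Ici 0) subset_rfl
    hab.le).exists_tendsto_atTop hF
  have hxy : Tendsto (fun t => a * (u t).1 * (u t).2.1) atTop (𝓝 0) := by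
    simpa using (hl.const_mul a).mul hy0
  have hz0 : Tendsto (fun t => (u t).2.2) atTop (𝓝 h) := by
    simpa [flux] using hh.sub hxy
  -- A negative limit of the flux would be the limit of f'', and f' would become negative in finite
  -- time.
  have hh0 : h = 0 := by
    refine le_antisymm (le_of_tendsto hh ((eventually_ge_atTop 0).mono hF)) ?_
    by_contra! hneg
    obtain ⟨T, hT⟩ := eventually_atTop.1 (hz0.eventually_lt_const (by linarith : h < h / 2))
    set S := max T 0
    have hS0 : 0 ≤ S := le_max_right _ _
    have hlin := antitoneOn_of_hasDerivWithinAt_Ici (f := fun t => (u t).2.1 - h / 2 * t)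
      (f' := fun t => (u t).2.2 - h / 2 * 1) (convex_Ici S) (Ici_subset_Ici.2 hS0)
      (fun t ht => (hu.snd (Ici_subset_Ici.2 hS0 ht)).sub
        ((hasDerivWithinAt_id t _).const_mul (h / 2)))
      (fun t ht => by linarith [hT t ((le_max_left _ _).trans ht)])
    have hd : 0 ≤ (u S).2.1 / (-(h / 2)) := div_nonneg (hy' S hS0) (by linarith)
    have h1 := hlin self_mem_Ici (show S ≤ S + (u S).2.1 / (-(h / 2)) by linarith) (by linarith)
    have h2 := hy (S + (u S).2.1 / (-(h / 2))) (by linarith)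
    have h3 : h / 2 * ((u S).2.1 / (-(h / 2))) = -(u S).2.1 := by
      field_simp [hneg.ne]
    simp only [mul_add, h3] at h1
    linarith
  subst hh0
  -- The derivative is -(a + b) f''(f - l) ≤ 0 and the limit is 0, so the flux dominates (a + b)
  -- f'(f - l).
  have hN := antitoneOn_of_hasDerivWithinAt_Ici
    (f := fun t => flux a (u t) - (a + b) * ((u t).2.1 * ((u t).1 - l)))
    (f' := fun t => (a + b) * (u t).2.1 ^ 2 -
      (a + b) * ((u t).2.2 * ((u t).1 - l) + (u t).2.1 * (u t).2.1)) (convex_Ici 0) subset_rfl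
    (fun t ht => (hu.hasDerivWithinAt_flux ht).sub
      (((hu.snd ht).mul ((hu.fst ht).sub_const l)).const_mul (a + b)))
    (fun t ht => by
      have : 0 ≤ (a + b) * (-(u t).2.2 * (l - (u t).1)) :=
        mul_nonneg hab.le (mul_nonneg (by linarith [hz t ht]) (by linarith [hxl t ht]))
      linarith)
  have hNlim : Tendsto (fun t => flux a (u t) - (a + b) * ((u t).2.1 * ((u t).1 - l))) atTop
      (𝓝 0) := by
    simpa using hh.sub ((hy0.mul (hl.sub_const l)).const_mul (a + b))
  have hNpos : ∀ t, 0 ≤ t → (a + b) * ((u t).2.1 * ((u t).1 - l)) ≤ flux a (u t) :=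
    fun t ht => by linarith [hN.ge_of_tendsto_atTop hNlim ht]
  rcases hl0.lt_or_eq with hlneg | rfl
  -- The bound reads f'' ≥ f'(b f - (a + b) l), whose bracket tends to -a l > 0, against f'' ≤ 0.
  · have h1 : Tendsto (fun t => b * (u t).1 - (a + b) * l) atTop (𝓝 (b * l - (a + b) * l)) :=
      (hl.const_mul b).sub_const _
    have h2 : 0 < b * l - (a + b) * l := by nlinarith
    obtain ⟨t, ht, ht0⟩ := ((h1.eventually_const_lt h2).and (eventually_ge_atTop 0)).exists
    have h3 := mul_pos (hy t ht0) ht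
    have h4 := hNpos t ht0
    simp only [flux] at h4
    nlinarith [hz t ht0]
  · have hxneg : ∀ t, 0 ≤ t → (u t).1 < 0 := fun t ht =>
      (hmono' ht (show (0 : ℝ) ≤ t + 1 by linarith) (by linarith)).trans_le
        (hxle (t + 1) (by linarith))
    have hyx := monotoneOn_of_hasDerivWithinAt_Ici
      (f := fun t => (u t).2.1 - b / 2 * (u t).1 ^ 2)
      (f' := fun t => (u t).2.2 - b * (u t).1 * (u t).2.1) (convex_Ici 0) subset_rfl
      (fun t ht => ((hu.snd ht).sub (((hu.fst ht).pow 2).const_mul (b / 2))).congr_deriv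
        (by simp; ring))
      (fun t ht => by
        have := hNpos t ht
        simp only [flux] at this
        linarith)
    have hyxlim : Tendsto (fun t => (u t).2.1 - b / 2 * (u t).1 ^ 2) atTop (𝓝 0) := by
      simpa using hy0.sub ((hl.pow 2).const_mul (b / 2))
    have hyle : ∀ t, 0 ≤ t → (u t).2.1 ≤ b / 2 * (u t).1 ^ 2 := fun t ht => by
      linarith [hyx.le_of_tendsto_atTop hyxlim ht]
    have hFlt : flux a (u 0) < 0 := by
      have hstrict : StrictMonoOn (fun t => flux a (u t)) (Ici 0) :=
        strictMonoOn_of_hasDerivWithinAt_pos (convex_Ici 0)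
          ((continuous_flux a).comp_continuousOn (hu.continuousOn subset_rfl))
          (fun t ht => (hu.hasDerivWithinAt_flux (interior_subset ht)).mono interior_subset)
          (fun t ht => mul_pos hab (pow_pos (hy t (interior_subset (s := Ici (0 : ℝ)) ht)) 2))
      exact (hstrict self_mem_Ici (show (0 : ℝ) ≤ 1 by norm_num) one_pos).trans_le (hF 1 one_pos.le)
    -- The exponent 3 matches b = 2a - 3: the coefficient of f f'² in the numerator is (a + b) - 3a
    -- = -3, so the derivative is nonnegative for f < 0, f' > 0, f'' ≤ 0.
    have hWd : ∀ t, 0 ≤ t → HasDerivWithinAt (fun t => flux a (u t) / (u t).1 ^ 3)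
        (-(3 * (u t).2.1 * ((u t).1 * (u t).2.1 + (u t).2.2)) / (u t).1 ^ 4) (Ici 0) t :=
      fun t ht => by
        have hne := (hxneg t ht).ne
        refine ((hu.hasDerivWithinAt_flux ht).div ((hu.fst ht).pow 3) (pow_ne_zero 3 hne)).congr_deriv ?_
        simp only [flux, hb, Pi.pow_apply]
        field_simp
        push_cast
        ring
    have hsum : ∀ t, 0 ≤ t → (u t).1 * (u t).2.1 + (u t).2.2 ≤ 0 := fun t ht => by
      nlinarith [mul_nonpos_of_nonpos_of_nonneg (hxle t ht) (hy' t ht), hz t ht]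
    have hW := monotoneOn_of_hasDerivWithinAt_Ici (convex_Ici 0) subset_rfl hWd fun t ht => by
      refine div_nonneg ?_ (by positivity)
      nlinarith [mul_nonneg (hy' t ht) (neg_nonneg.2 (hsum t ht))]
    set c := flux a (u 0) / (u 0).1 ^ 3 / (a + b) with hc
    have hcube : ∀ t, 0 ≤ t → (u t).1 ^ 3 < 0 := fun t ht => Odd.pow_neg (by decide) (hxneg t ht)
    have hc0 : 0 < c := div_pos (div_pos_of_neg_of_neg hFlt (hcube 0 le_rfl)) hab
    have hWle : ∀ t, 0 ≤ t → flux a (u t) / (u t).1 ^ 3 ≤ (a + b) * ((u t).2.1 / (u t).1 ^ 2) :=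
      fun t ht => by
        have hne := (hxneg t ht).ne
        rw [div_le_iff_of_neg (hcube t ht)]
        have : (a + b) * ((u t).2.1 / (u t).1 ^ 2) * (u t).1 ^ 3 =
            (a + b) * ((u t).2.1 * ((u t).1 - 0)) := by field_simp; ring
        rw [this]
        exact hNpos t ht
    have hyc : ∀ t, 0 ≤ t → c ≤ (u t).2.1 / (u t).1 ^ 2 := fun t ht => by
      rw [hc, div_le_iff₀ hab, mul_comm]
      exact (hW self_mem_Ici ht ht).trans (hWle t ht)
    have hyc' : ∀ t, 0 ≤ t → c * (u t).1 ^ 2 ≤ (u t).2.1 := fun t ht =>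
      (le_div_iff₀ (sq_pos_of_neg (hxneg t ht))).1 (hyc t ht)
    have hWbd : ∀ t, 0 ≤ t → flux a (u t) / (u t).1 ^ 3 ≤ (a + b) * (b / 2) := fun t ht => by
      refine (hWle t ht).trans ?_
      exact mul_le_mul_of_nonneg_left
        ((div_le_iff₀ (sq_pos_of_neg (hxneg t ht))).2 (hyle t ht)) hab.le
    -- By f' ≥ c f², the derivative of flux / f³ is at least -3c f'/f. As `Real.log` of a negative
    -- number is log |f| → -∞, the quotient would be unbounded, contrary to `hWbd`.
    have hlog := monotoneOn_of_hasDerivWithinAt_Ici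
      (f := fun t => flux a (u t) / (u t).1 ^ 3 + 3 * c * Real.log (u t).1)
      (f' := fun t => -(3 * (u t).2.1 * ((u t).1 * (u t).2.1 + (u t).2.2)) / (u t).1 ^ 4 +
        3 * c * ((u t).2.1 / (u t).1)) (convex_Ici 0) subset_rfl
      (fun t ht => (hWd t ht).add (((hu.fst ht).log (hxneg t ht).ne).const_mul (3 * c)))
      (fun t ht => by
        have hne := (hxneg t ht).ne
        have : -(3 * (u t).2.1 * ((u t).1 * (u t).2.1 + (u t).2.2)) / (u t).1 ^ 4 +
            3 * c * ((u t).2.1 / (u t).1) =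
            3 * (u t).2.1 * (-(u t).2.2 + -(u t).1 * ((u t).2.1 - c * (u t).1 ^ 2)) /
              (u t).1 ^ 4 := by
          field_simp
          ring
        rw [this]
        have h1 := hyc' t ht
        have h2 := hxneg t ht
        have h3 := hz t ht
        have h4 := hy t ht
        refine div_nonneg (mul_nonneg (by linarith) (add_nonneg (by linarith)
          (mul_nonneg (by linarith) (by linarith)))) (by positivity))
    have hbot : Tendsto (fun t => Real.log (u t).1) atTop atBot := by
      refine Real.tendsto_log_nhdsNE_zero.comp (tendsto_nhdsWithin_iff.2 ⟨hl, ?_⟩)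
      exact (eventually_ge_atTop 0).mono fun t ht => (hxneg t ht).ne
    have hbot' : Tendsto (fun t => 3 * c * Real.log (u t).1) atTop atBot :=
      hbot.const_mul_atBot (by positivity)
    obtain ⟨t, ht, ht0⟩ := ((hbot'.eventually_lt_atBot
      (flux a (u 0) / (u 0).1 ^ 3 + 3 * c * Real.log (u 0).1 - (a + b) * (b / 2))).and
      (eventually_ge_atTop 0)).exists
    have h1 := hlog self_mem_Ici ht0 ht0
    have h2 := hWbd t ht0
    simp only at h1
    linarith

end Trapped

/-! ### Translation to the boundary value problem, and uniqueness. -/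

section BoundaryValueProblem

variable {m γ : ℝ} {f g : ℝ → ℝ}

theorem iteratedDerivWithin_two_eq (f : ℝ → ℝ) (s : Set ℝ) :
    iteratedDerivWithin 2 f s = derivWithin (derivWithin f s) s := by
  rw [iteratedDerivWithin_succ, iteratedDerivWithin_one]

/-- The trajectory `(f, f', f'')` of a function on `[0, ∞)`. -/
noncomputable def jet (f : ℝ → ℝ) (t : ℝ) : ℝ × ℝ × ℝ :=
  (f t, derivWithin f (Ici 0) t, iteratedDerivWithin 2 f (Ici 0) t)

theorem IsBoundaryLayerSolution.solvesOn_jet (hf : IsBoundaryLayerSolution m γ f) :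
    SolvesOn (layerField (m + 2) (2 * m + 1)) (jet f) (Ici 0) := fun t ht => by
  have hd := fun k (hk : k < 3) => hf.contDiffOn.differentiableOn_iteratedDerivWithin
    (m := k) (by exact_mod_cast hk) (uniqueDiffOn_Ici 0) t ht
  have h0 := (hd 0 (by norm_num)).hasDerivWithinAt
  have h1 := (hd 1 (by norm_num)).hasDerivWithinAt
  have h2 := (hd 2 (by norm_num)).hasDerivWithinAt
  rw [iteratedDerivWithin_zero] at h0
  rw [iteratedDerivWithin_one, ← iteratedDerivWithin_two_eq] at h1
  rw [← iteratedDerivWithin_succ] at h2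
  refine (h0.prodMk (h1.prodMk h2)).congr_deriv ?_
  have := hf.ode t ht
  simp only [layerField, jet, Prod.mk.injEq, true_and]
  linarith

theorem IsConcaveBoundaryLayerSolution.antitoneOn_derivWithin
    (hf : IsConcaveBoundaryLayerSolution m γ f) : AntitoneOn (derivWithin f (Ici 0)) (Ici 0) :=
  hf.concaveOn.antitoneOn_derivWithin (hf.contDiffOn.differentiableOn (by norm_num))

theorem IsConcaveBoundaryLayerSolution.iteratedDerivWithin_two_nonpos
    (hf : IsConcaveBoundaryLayerSolution m γ f) (t : ℝ) :
    iteratedDerivWithin 2 f (Ici 0) t ≤ 0 := by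
  rw [iteratedDerivWithin_two_eq]
  exact hf.antitoneOn_derivWithin.derivWithin_nonpos

theorem IsConcaveBoundaryLayerSolution.derivWithin_nonneg
    (hf : IsConcaveBoundaryLayerSolution m γ f) {t : ℝ} (ht : 0 ≤ t) :
    0 ≤ derivWithin f (Ici 0) t :=
  hf.antitoneOn_derivWithin.ge_of_tendsto_atTop hf.deriv_infty ht

/-- A larger initial slope keeps the slopes apart, so only one can tend to `0`. -/
theorem IsConcaveBoundaryLayerSolution.derivWithin_zero_le (hm : -(1 / 2) ≤ m)
    (hf : IsConcaveBoundaryLayerSolution m γ f) (hg : IsConcaveBoundaryLayerSolution m γ g) :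
    derivWithin f (Ici 0) 0 ≤ derivWithin g (Ici 0) 0 := by
  by_contra! hlt
  have hF := hf.solvesOn_jet
  have hG := hg.solvesOn_jet
  have hd0 : ∀ t ∈ Ici (0 : ℝ), HasDerivWithinAt (fun t => f t - g t)
      (derivWithin f (Ici 0) t - derivWithin g (Ici 0) t) (Ici 0) t :=
    fun t ht => (hF.fst ht).sub (hG.fst ht)
  have hd1 : ∀ t ∈ Ici (0 : ℝ), HasDerivWithinAt
      (fun t => derivWithin f (Ici 0) t - derivWithin g (Ici 0) t)
      (iteratedDerivWithin 2 f (Ici 0) t - iteratedDerivWithin 2 g (Ici 0) t) (Ici 0) t :=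
    fun t ht => (hF.snd ht).sub (hG.snd ht)
  have hd2 := fun t (ht : t ∈ Ici (0 : ℝ)) => (hF.thd ht).sub (hG.thd ht)
  -- For h = f - g with h' ≥ 0 on `[0, T]`: h ≥ 0, and h''' + a f h'' = -a g'' h + b (f' + g') h' ≥
  -- 0 with h''(0) = 0. So h'' ≥ 0 and h' does not decrease.
  have hstep : ∀ T, 0 ≤ T →
      (∀ t ∈ Icc 0 T, 0 ≤ derivWithin f (Ici 0) t - derivWithin g (Ici 0) t) →
      derivWithin f (Ici 0) 0 - derivWithin g (Ici 0) 0 ≤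
        derivWithin f (Ici 0) T - derivWithin g (Ici 0) T := by
    intro T hT hnn
    have hh : ∀ t ∈ Icc 0 T, 0 ≤ f t - g t := fun t ht => by
      have := monotoneOn_of_hasDerivWithinAt_Ici (convex_Icc 0 T) Icc_subset_Ici_self
        (fun t ht => hd0 t ht.1) hnn ⟨le_rfl, hT⟩ ht ht.1
      simpa [hf.value_zero, hg.value_zero] using this
    have hsec : ∀ t ∈ Icc 0 T,
        0 ≤ iteratedDerivWithin 2 f (Ici 0) t - iteratedDerivWithin 2 g (Ici 0) t := by
      intro t ht
      obtain ⟨κ, hκ, hle⟩ := exists_pos_mul_le_of_linear_le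
        (c := fun t => -((m + 2) * f t)) le_rfl ht.1
        ((hf.contDiffOn.continuousOn.mono Icc_subset_Ici_self).const_smul (m + 2)).neg
        (fun s hs => hd2 s hs.1) (fun s hs => by
          have hs' : s ∈ Icc 0 T := ⟨hs.1, hs.2.trans ht.2⟩
          have h1 : 0 ≤ (m + 2) * (-iteratedDerivWithin 2 g (Ici 0) s * (f s - g s)) :=
            mul_nonneg (by linarith) (mul_nonneg
              (by linarith [hg.iteratedDerivWithin_two_nonpos s]) (hh s hs'))
          have h2 : 0 ≤ (2 * m + 1) *
              ((derivWithin f (Ici 0) s + derivWithin g (Ici 0) s) *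
                (derivWithin f (Ici 0) s - derivWithin g (Ici 0) s)) :=
            mul_nonneg (by linarith) (mul_nonneg
              (add_nonneg (hf.derivWithin_nonneg hs.1) (hg.derivWithin_nonneg hs.1)) (hnn s hs'))
          simp only [jet, Pi.sub_apply]
          linarith)
      simpa [jet, hf.second_deriv_zero, hg.second_deriv_zero] using hle
    exact monotoneOn_of_hasDerivWithinAt_Ici (convex_Icc 0 T) Icc_subset_Ici_self
      (fun t ht => hd1 t ht.1) hsec ⟨le_rfl, hT⟩ ⟨hT, le_rfl⟩ hT
  have hpos : ∀ t, 0 ≤ t → 0 < derivWithin f (Ici 0) t - derivWithin g (Ici 0) t := by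
    intro T hT
    by_contra! hle
    obtain ⟨s, hs, hs0, hlt'⟩ := exists_first_zero hT
      (fun t ht => (hd1 t ht.1).continuousWithinAt.mono Icc_subset_Ici_self)
      (by linarith) hle
    have := hstep s hs.1.le fun t ht => by
      rcases ht.2.eq_or_lt with rfl | h
      · exact hs0.ge
      · exact (hlt' t ⟨ht.1, h⟩).le
    linarith
  have hlim : Tendsto (fun t => derivWithin f (Ici 0) t - derivWithin g (Ici 0) t) atTop (𝓝 0) := by
    simpa using hf.deriv_infty.sub hg.deriv_infty
  have := ge_of_tendsto hlim ((eventually_ge_atTop 0).mono fun t ht =>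
    hstep t ht fun s hs => (hpos s hs.1).le)
  linarith

theorem IsConcaveBoundaryLayerSolution.eqOn (hm : -(1 / 2) ≤ m)
    (hf : IsConcaveBoundaryLayerSolution m γ f) (hg : IsConcaveBoundaryLayerSolution m γ g) :
    EqOn f g (Ici 0) := fun t ht => by
  have h0 : jet f 0 = jet g 0 := by
    simp [jet, hf.value_zero, hg.value_zero, hf.second_deriv_zero, hg.second_deriv_zero,
      le_antisymm (hf.derivWithin_zero_le hm hg) (hg.derivWithin_zero_le hm hf)]
  exact congrArg Prod.fst (SolvesOn.eqOn (hasLipschitzTruncations_layerField _ _)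
    (hf.solvesOn_jet.mono Icc_subset_Ici_self) (hg.solvesOn_jet.mono Icc_subset_Ici_self) h0
    ⟨ht, le_rfl⟩)

theorem SolvesOn.jet_fst {a b : ℝ} {u : ℝ → ℝ × ℝ × ℝ}
    (hu : SolvesOn (layerField a b) u (Ici 0)) :
    EqOn (derivWithin (fun t => (u t).1) (Ici 0)) (fun t => (u t).2.1) (Ici 0) ∧
    EqOn (iteratedDerivWithin 2 (fun t => (u t).1) (Ici 0)) (fun t => (u t).2.2) (Ici 0) ∧
    EqOn (iteratedDerivWithin 3 (fun t => (u t).1) (Ici 0))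
      (fun t => -(a * (u t).1 * (u t).2.2) + b * (u t).2.1 ^ 2) (Ici 0) := by
  have hU := uniqueDiffOn_Ici (0 : ℝ)
  have h1 : EqOn (derivWithin (fun t => (u t).1) (Ici 0)) (fun t => (u t).2.1) (Ici 0) :=
    fun t ht => (hu.fst ht).derivWithin (hU t ht)
  have h2 : EqOn (iteratedDerivWithin 2 (fun t => (u t).1) (Ici 0)) (fun t => (u t).2.2)
      (Ici 0) := fun t ht => by
    rw [iteratedDerivWithin_two_eq, derivWithin_congr h1 (h1 ht)]
    exact (hu.snd ht).derivWithin (hU t ht)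
  refine ⟨h1, h2, fun t ht => ?_⟩
  rw [iteratedDerivWithin_succ, derivWithin_congr h2 (h2 ht)]
  exact (hu.thd ht).derivWithin (hU t ht)

theorem SolvesOn.contDiffOn_fst {a b : ℝ} {u : ℝ → ℝ × ℝ × ℝ}
    (hu : SolvesOn (layerField a b) u (Ici 0)) :
    ContDiffOn ℝ 3 (fun t => (u t).1) (Ici 0) := by
  obtain ⟨h1, h2, h3⟩ := hu.jet_fst
  have hc := hu.continuousOn subset_rfl
  refine (contDiffOn_nat_iff_continuousOn_differentiableOn_deriv (n := 3)
    (uniqueDiffOn_Ici 0)).2 ⟨fun k hk => ?_, fun k hk => ?_⟩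
  · interval_cases k
    · rw [iteratedDerivWithin_zero]; exact hc.fst
    · rw [iteratedDerivWithin_one]; exact hc.snd.fst.congr h1
    · exact hc.snd.snd.congr h2
    · refine ContinuousOn.congr ?_ h3
      exact ((hc.fst.const_smul a).mul hc.snd.snd).neg.add ((hc.snd.fst.pow 2).const_smul b)
  · interval_cases k
    · rw [iteratedDerivWithin_zero]; exact fun t ht => (hu.fst ht).differentiableWithinAt
    · rw [iteratedDerivWithin_one]
      exact DifferentiableOn.congr (fun t ht => (hu.snd ht).differentiableWithinAt) h1
    · exact DifferentiableOn.congr (fun t ht => (hu.thd ht).differentiableWithinAt) h2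

theorem SolvesOn.concaveOn_fst {a b : ℝ} {u : ℝ → ℝ × ℝ × ℝ}
    (hu : SolvesOn (layerField a b) u (Ici 0)) (hz : ∀ t, 0 ≤ t → (u t).2.2 ≤ 0) :
    ConcaveOn ℝ (Ici 0) fun t => (u t).1 :=
  concaveOn_of_hasDerivWithinAt2_nonpos (convex_Ici 0) (hu.continuousOn subset_rfl).fst
    (fun _ ht => (hu.fst (interior_subset ht)).mono interior_subset)
    (fun _ ht => (hu.snd (interior_subset ht)).mono interior_subset)
    (fun t ht => hz t (interior_subset (s := Ici (0 : ℝ)) ht))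

end BoundaryValueProblem

theorem mainTheorem2 (m γ : ℝ) (hm : -(1 / 2) ≤ m) :
    ∃ f : ℝ → ℝ, IsConcaveBoundaryLayerSolution m γ f ∧
      (∀ g : ℝ → ℝ, IsConcaveBoundaryLayerSolution m γ g → EqOn g f (Ici 0)) ∧
      (∀ᶠ t in atTop, 0 < f t) ∧
      (∀ t : ℝ, 0 ≤ t →
        -γ ≤ f t ∧ f t ≤ Real.sqrt (γ ^ 2 + 2 * derivWithin f (Ici 0) 0 / (m + 2))) := by
  have ha : 1 < m + 2 := by linarith
  have hb : 0 ≤ 2 * m + 1 := by linarith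
  obtain ⟨α, hα, u, h0, hu, htr⟩ := exists_trapped_solution γ ha hb
  have hy := fun t ht => (htr t ht).1
  have hy' := fun t ht => (htr t ht).1.le
  have hz := fun t ht => (htr t ht).2.1
  have hF := fun t ht => (htr t ht).2.2
  have ha0 : 0 < m + 2 := by linarith
  obtain ⟨h1, h2, h3⟩ := hu.jet_fst
  have hf : IsConcaveBoundaryLayerSolution m γ fun t => (u t).1 :=
    { contDiffOn := hu.contDiffOn_fst
      ode := fun t ht => by
        rw [h1 ht, h2 ht, h3 ht]
        ring
      value_zero := by simp [h0]
      deriv_infty := (hu.tendsto_snd ha0 hy' hz hF).congr'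
        ((eventually_ge_atTop 0).mono fun t ht => (h1 ht).symm)
      second_deriv_zero := by rw [h2 self_mem_Ici]; simp [h0]
      concaveOn := hu.concaveOn_fst hz }
  -- The `ring` goal is the relation 2m + 1 = 2(m + 2) - 3 needed for positivity at infinity.
  refine ⟨_, hf, fun g hg => hg.eqOn hm hf,
    hu.eventually_pos ha (by ring) hb hy hz hF, fun t ht => ⟨?_, ?_⟩⟩
  · simpa [h0] using hu.fst_monotoneOn (convex_Ici 0) subset_rfl hy' self_mem_Ici ht ht
  · have := (le_abs_self _).trans (hu.fst_abs_le ha0 hy' hF ht)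
    rw [h1 self_mem_Ici]
    simpa [h0] using this
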